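/- Let $\mathrm{Fin}\times\mathrm{Fin}$ be the ideal of all $A\subseteq\mathbb N\times\mathbb N$ such that $\{m:(n,m)\in A\}$ is finite for all but finitely many $n$. Let $Z=(\mathbb N\times\mathbb N)\cup\{\infty\}$ be the space in which every point of $\mathbb N\times\mathbb N$ is isolated and the neighborhoods of $\infty$ are the sets $A\cup\{\infty\}$ with $(\mathbb N\times\mathbb N)\setminus A\in\mathrm{Fin}\times\mathrm{Fin}$. There are functions $f:Z\to Z$ such that (a) $f(\infty)=\infty$, and (b) $f^{-1}(\{n\}\times\mathbb N)=\{n\}\times\mathbb N$ and $f^{-1}((n,m))$ has exactly two points, for all $n,m\in\mathbb N$. Every such $f$ is continuous. Let $f$ be such a function, let $X_\infty=\varprojlim\{Z,f\}=\{(x_k)_k\in Z^{\mathbb N}: x_k=f(x_{k+1})\text{ for all }k\}$ with the topology induced by the product topology, let $\pi$ be its projection onto the first coordinate, and let $p\in X_\infty$ be the constant sequence $\infty$. Then there are nonempty countable sets $D_{n,m}\subseteq\pi^{-1}((n,m))$ ($n,m\in\mathbb N$) without isolated points in the subspace topology, and for every such choice the subspace $X=\{p\}\cup\bigcup_{n,m}D_{n,m}$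 of $X_\infty$ is a countable regular ($T_3$) space with the following properties: - $X$ is crowded, i.e. it has no isolated points; - $X$ has analytic topology, i.e. its topology is an analytic subset of the Cantor cube $2^X$; - $X$ is $q^+$: whenever $A\subseteq X$, $x\in\overline A$ and $(F_n)_n$ is a partition of $A$ into finite sets, there is $S\subseteq A$ with $x\in\overline S$ and $|S\cap F_n|\le 1$ for all $n$; - $X$ is discretely generated: whenever $A\subseteq X$ and $x\in\overline A$, there is a discrete subspace $E\subseteq A$ with $x\in\overline E$; - $X$ is selectively separable: for every sequence $(Y_n)_n$ of dense subsets of $X$ there are finite $K_n\subseteq Y_n$ such that $\bigcup_n K_n$ is dense in $X$; - $X$ does not have countable fan-tightness, i.e. it is not true that for all $x\in X$ and all sequences $(A_n)_n$ of subsets of $X$ with $x\in\bigcap_n\overline{A_n}$ there are finite $K_n\subseteq A_n$ with $x\in\overline{\bigcup_n K_n}$. -/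

import Mathlib

/-- Countable fan-tightness. -/
def HasCountableFanTightness (X : Type*) [TopologicalSpace X] : Prop :=
  ∀ (x : X) (A : ℕ → Set X), (∀ n, x ∈ closure (A n)) →
    ∃ K : ℕ → Set X, (∀ n, (K n).Finite ∧ K n ⊆ A n) ∧ x ∈ closure (⋃ n, K n)

/-- `q⁺` spaces. The pieces of a partition into finite sets are allowed to be empty. -/
def IsQPlus (X : Type*) [TopologicalSpace X] : Prop :=
  ∀ (A : Set X) (x : X), x ∈ closure A →
    ∀ F : ℕ → Set X, (∀ n, (F n).Finite) → Pairwise (fun i j => Disjoint (F i) (F j)) →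
      (⋃ n, F n) = A →
      ∃ S : Set X, S ⊆ A ∧ x ∈ closure S ∧ ∀ n, (S ∩ F n).Subsingleton

/-- Discretely generated spaces. -/
def IsDiscretelyGenerated (X : Type*) [TopologicalSpace X] : Prop :=
  ∀ (A : Set X) (x : X), x ∈ closure A →
    ∃ E : Set X, E ⊆ A ∧ DiscreteTopology E ∧ x ∈ closure E

/-- Selectively separable spaces. -/
def IsSelectivelySeparable (X : Type*) [TopologicalSpace X] : Prop :=
  ∀ D : ℕ → Set X, (∀ n, Dense (D n)) →
    ∃ K : ℕ → Set X, (∀ n, (K n).Finite ∧ K n ⊆ D n) ∧ Dense (⋃ n, K n)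

/-- The topology of the (countable) space `X` is an analytic subset of the Cantor cube `2^X`,
subsets of `X` being identified with their characteristic functions. -/
def HasAnalyticTopology (X : Type*) [TopologicalSpace X] : Prop :=
  MeasureTheory.AnalyticSet {χ : X → Bool | IsOpen {x : X | χ x = true}}

/-- The space `Z(F) = X ∪ {∞}`, for a filter `F` on `X`. -/
def FilterSpace {X : Type*} (_F : Filter X) : Type _ := Option X

namespace FilterSpace

variable {X : Type*} {F : Filter X}

/-- The point of `Z(F)` given by an element of `X`. -/
def pt (x : X) : FilterSpace F := (some x : Option X)

/-- The point `∞` of `Z(F)`. -/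
def infty : FilterSpace F := (none : Option X)

/-- Points of `X` are isolated in `Z(F)`, and the sets `A ∪ {∞}` with `A ∈ F` are the
neighbourhoods of `∞`. -/
instance : TopologicalSpace (FilterSpace F) where
  IsOpen U := infty ∈ U → {x : X | pt x ∈ U} ∈ F
  isOpen_univ := fun _ => by simp
  isOpen_inter := fun U V hU hV h => Filter.inter_mem (hU h.1) (hV h.2)
  isOpen_sUnion := fun S hS h => by
    obtain ⟨U, hUS, hU⟩ := h
    exact Filter.mem_of_superset (hS U hUS hU) (fun x hx => ⟨U, hUS, hx⟩)

end FilterSpace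

/-- The ideal `Fin × Fin` on `ℕ × ℕ`: all but finitely many columns of `A` are finite. -/
def finTimesFin : Set (Set (ℕ × ℕ)) :=
  {A | {n : ℕ | ¬ {m : ℕ | (n, m) ∈ A}.Finite}.Finite}

/-- The filter dual to `Fin × Fin`. -/
def finTimesFinDual : Filter (ℕ × ℕ) where
  sets := {A | Aᶜ ∈ finTimesFin}
  univ_sets := by simp [finTimesFin]
  sets_of_superset := by
    intro A B hA hAB
    refine Set.Finite.subset hA (fun n hn hf => hn (hf.subset ?_))
    intro m hm hmA
    exact hm (hAB hmA)
  inter_sets := by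
    intro A B hA hB
    refine Set.Finite.subset (Set.Finite.union hA hB) (fun n hn => ?_)
    by_contra h
    simp only [Set.mem_union, Set.mem_ofPred_eq, not_or, not_not] at h
    refine hn ((h.1.union h.2).subset ?_)
    intro m hm
    by_cases hmA : (n, m) ∈ A
    · exact Or.inr (fun hmB => hm ⟨hmA, hmB⟩)
    · exact Or.inl hmA

/-- The inverse limit of a sequence of spaces, as a subset of the product; each of its subsets
carries the topology induced by the product topology. -/
def inverseLimit {X : ℕ → Type*} (f : ∀ n, X (n + 1) → X n) : Set (∀ n, X n) :=
  {x | ∀ n, x n = f n (x (n + 1))}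

/-- The space `Z = Z((Fin × Fin)*)`. -/
abbrev FinFinSpace : Type := FilterSpace finTimesFinDual

/-- The maps `f : Z → Z` with `f(∞) = ∞`, `f⁻¹({n} × ℕ) = {n} × ℕ` for every `n`, and such that
`f⁻¹((n, m))` has exactly two points for all `n, m`. -/
structure IsColumnDoubling (f : FinFinSpace → FinFinSpace) : Prop where
  map_infty : f FilterSpace.infty = FilterSpace.infty
  preimage_column : ∀ n : ℕ,
    f ⁻¹' (Set.range fun m : ℕ => FilterSpace.pt (n, m)) =
      Set.range fun m : ℕ => FilterSpace.pt (n, m)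
  preimage_point : ∀ n m : ℕ, (f ⁻¹' {FilterSpace.pt (n, m)}).ncard = 2

/-- A choice, for all `n, m`, of a nonempty countable set `D n m` without isolated points
inside the fibre over `(n, m)` of the first projection of the inverse limit of `{Z, f}`. -/
structure IsCrowdedSelection (f : FinFinSpace → FinFinSpace)
    (D : ℕ → ℕ → Set (ℕ → FinFinSpace)) : Prop where
  nonempty : ∀ n m, (D n m).Nonempty
  countable : ∀ n m, (D n m).Countable
  crowded : ∀ n m, PerfectSpace (D n m)
  subset_limit : ∀ n m, D n m ⊆ inverseLimit (fun _ => f)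
  first_coord : ∀ n m, ∀ x ∈ D n m, x 0 = FilterSpace.pt (n, m)

/-- The union of all `D n m`, together with the constant sequence `∞`. -/
def selectionSpace (D : ℕ → ℕ → Set (ℕ → FinFinSpace)) : Set (ℕ → FinFinSpace) :=
  (⋃ n, ⋃ m, D n m) ∪ {fun _ => FilterSpace.infty}

/-! A column-doubling `f` preserves columns and is finite-to-one on each, so it pulls the
neighbourhood filter of `∞` back to itself. Hence all coordinates of the inverse limit induce the
same filter at `p`, and `𝓝 p` is the pullback of `𝓝 ∞` along `π` (`comap_nhds_infty`,
`isFinFinFibration`). At any other point all coordinates are isolated, and cylinders form a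
countable base.

These facts, packaged in `IsFinFinFibration`, carry the argument. By `base_mem_closure`, a set
missing `p` accumulates at `p` exactly when, for infinitely many `n`, it meets the fibres over
infinitely many `(n, m)`. Fan-tightness fails because the sets over the columns `≥ k` accumulate at
`p`, while finite choices leave only finitely many points over each column. The positive properties
follow from this criterion at `p` and from first countability elsewhere. -/

open Filter Topology

/-! ### Neighbourhoods in `Z(F)` and in `Z`. -/

namespace FilterSpace

variable {X : Type*} {F : Filter X}

theorem isOpen_iff {U : Set (FilterSpace F)} :
    IsOpen U ↔ (infty ∈ U → {x : X | pt x ∈ U} ∈ F) := Iff.rfl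

theorem pt_ne_infty (x : X) : (pt x : FilterSpace F) ≠ infty := Option.some_ne_none x

theorem pt_injective : Function.Injective (pt : X → FilterSpace F) := Option.some_injective X

theorem eq_infty_or_eq_pt (z : FilterSpace F) : z = infty ∨ ∃ x, z = pt x := by
  cases z with
  | none => exact Or.inl rfl
  | some x => exact Or.inr ⟨x, rfl⟩

theorem isOpen_of_infty_notMem {U : Set (FilterSpace F)} (h : infty ∉ U) : IsOpen U :=
  fun h' => absurd h' h

theorem mem_nhds_infty {U : Set (FilterSpace F)} :
    U ∈ 𝓝 (infty : FilterSpace F) ↔ infty ∈ U ∧ {x : X | pt x ∈ U} ∈ F := by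
  constructor
  · intro h
    obtain ⟨V, hVU, hV, hi⟩ := mem_nhds_iff.1 h
    exact ⟨hVU hi, mem_of_superset (hV hi) fun x hx => hVU hx⟩
  · rintro ⟨h1, h2⟩
    exact IsOpen.mem_nhds (fun _ => h2) h1

theorem nhds_pt (x : X) : 𝓝 (pt x : FilterSpace F) = pure (pt x) :=
  (isOpen_singleton_iff_nhds_eq_pure _).1 (isOpen_of_infty_notMem fun h => pt_ne_infty x h.symm)

end FilterSpace

theorem mem_finTimesFinDual {A : Set (ℕ × ℕ)} :
    A ∈ finTimesFinDual ↔ ∀ᶠ n in atTop, ∀ᶠ m in atTop, (n, m) ∈ A := by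
  rw [← Nat.cofinite_eq_atTop]
  rfl

/-- A map `π : X → Z` that is continuous, hits all isolated points, and has `p` as its only point
over `∞`; the neighbourhoods of `p` come from `Z`, and `X` is first countable elsewhere. -/
structure IsFinFinFibration {X : Type*} [TopologicalSpace X] (π : X → FinFinSpace) (p : X) :
    Prop where
  nhds_eq : 𝓝 p = comap π (𝓝 FilterSpace.infty)
  eq_infty_iff : ∀ x, π x = FilterSpace.infty ↔ x = p
  continuous : Continuous π
  exists_eq_pt : ∀ z, ∃ x, π x = FilterSpace.pt z
  isCountablyGenerated : ∀ x, x ≠ p → (𝓝 x).IsCountablyGenerated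

/-- Choose recursively, avoiding the finitely many labels `ν` already used. For `q⁺`, the label of a
point is the index of its piece. -/
theorem exists_injective_selection {X ι : Type*} [Countable ι] (ν : X → ℕ) (B : ι → Set X)
    (hB : ∀ i, (ν '' B i).Infinite) :
    ∃ s : ι → X, (∀ i, s i ∈ B i) ∧ Function.Injective (ν ∘ s) := by
  classical
  have h : ∀ (i : ι) (L : Finset ℕ), ∃ a ∈ B i, ν a ∉ L := by
    intro i L
    obtain ⟨k, ⟨a, ha, rfl⟩, hk⟩ := (hB i).exists_notMem_finset L
    exact ⟨a, ha, hk⟩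
  choose g hg hgL using h
  cases isEmpty_or_nonempty ι with
  | inl _ => exact ⟨isEmptyElim, isEmptyElim, fun i => isEmptyElim i⟩
  | inr _ =>
    obtain ⟨e, he⟩ := exists_injective_nat ι
    let d : ℕ → ι := Function.invFun e
    have hd : ∀ i, d (e i) = i := Function.leftInverse_invFun he
    -- `T n` holds the labels used before stage `n`; stages outside the range of `e` merely forbid
    -- extra labels.
    let T : ℕ → Finset ℕ := fun n => Nat.rec ∅ (fun k L => insert (ν (g (d k) L)) L) n
    have hT : ∀ n, T (n + 1) = insert (ν (g (d n) (T n))) (T n) := fun n => rfl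
    have hmono : Monotone T := monotone_nat_of_le_succ fun n => by
      rw [hT]; exact Finset.subset_insert _ _
    have key : ∀ m n, m < n → ν (g (d m) (T m)) ≠ ν (g (d n) (T n)) := by
      intro m n hmn heq
      refine hgL (d n) (T n) (heq ▸ hmono (Nat.succ_le_of_lt hmn) ?_)
      rw [Nat.succ_eq_add_one, hT]
      exact Finset.mem_insert_self _ _
    refine ⟨fun i => g i (T (e i)), fun i => hg _ _, fun i j hij => he ?_⟩
    simp only [Function.comp_apply] at hij
    rcases lt_trichotomy (e i) (e j) with hlt | heq | hlt
    · have := key _ _ hlt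
      rw [hd, hd] at this
      exact absurd hij this
    · exact heq
    · have := key _ _ hlt
      rw [hd, hd] at this
      exact absurd hij.symm this

/-- A neighbourhood of `u n` separated from the limit contains only finitely many terms, and those
different from `u n` can be deleted. -/
theorem discreteTopology_range_of_tendsto {X : Type*} [TopologicalSpace X] [T2Space X]
    {u : ℕ → X} {x : X} (hu : Tendsto u atTop (𝓝 x)) (hne : ∀ n, u n ≠ x) :
    DiscreteTopology (Set.range u) := by
  rw [discreteTopology_subtype_iff']
  rintro _ ⟨n, rfl⟩
  obtain ⟨V, W, hV, hW, hyV, hxW, hVW⟩ := t2_separation (hne n)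
  obtain ⟨N, hN⟩ := eventually_atTop.1 (hu.eventually_mem (hW.mem_nhds hxW))
  have hfin : (u '' Set.Iio N \ {u n}).Finite := ((Set.finite_Iio N).image u).sdiff
  refine ⟨V \ (u '' Set.Iio N \ {u n}), hV.sdiff hfin.isClosed, ?_⟩
  ext y
  constructor
  · rintro ⟨⟨hyV', hy⟩, k, rfl⟩
    by_contra hk
    refine hy ⟨⟨k, ?_, rfl⟩, hk⟩
    by_contra hkN
    exact hVW.le_bot ⟨hyV', hN k (not_lt.1 hkN)⟩
  · rintro rfl
    exact ⟨⟨hyV, fun h' => h'.2 rfl⟩, n, rfl⟩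

theorem polishSpace_pi_bool (X : Type*) [Countable X] : PolishSpace (X → Bool) := by
  have := TopologicalSpace.metrizableSpace_of_t3_secondCountable (X → Bool)
  let := TopologicalSpace.metrizableSpaceMetric (X → Bool)
  infer_instance

/-! ### Topological properties of fibrations over `Z`. -/

namespace IsFinFinFibration

variable {X : Type*} [TopologicalSpace X] {π : X → FinFinSpace} {p : X}

theorem apply_base (h : IsFinFinFibration π p) : π p = FilterSpace.infty :=
  (h.eq_infty_iff p).2 rfl

theorem exists_pt_of_ne (h : IsFinFinFibration π p) {x : X} (hx : x ≠ p) :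
    ∃ z, π x = FilterSpace.pt z :=
  (FilterSpace.eq_infty_or_eq_pt (π x)).resolve_left fun h' => hx ((h.eq_infty_iff x).1 h')

theorem ne_of_eq_pt (h : IsFinFinFibration π p) {x : X} {z : ℕ × ℕ}
    (hx : π x = FilterSpace.pt z) : x ≠ p := by
  rintro rfl
  exact FilterSpace.pt_ne_infty z (hx.symm.trans h.apply_base)

theorem isOpen_fiber (h : IsFinFinFibration π p) (z : ℕ × ℕ) :
    IsOpen {x | π x = FilterSpace.pt z} :=
  (FilterSpace.isOpen_of_infty_notMem (U := {FilterSpace.pt z})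
    fun h' => FilterSpace.pt_ne_infty z h'.symm).preimage h.continuous

theorem mem_nhds_base (h : IsFinFinFibration π p) {U : Set X} :
    U ∈ 𝓝 p ↔ p ∈ U ∧ ∀ᶠ n in atTop, ∀ᶠ m in atTop, ∀ y, π y = FilterSpace.pt (n, m) → y ∈ U := by
  rw [h.nhds_eq, mem_comap_iff_compl, FilterSpace.mem_nhds_infty, mem_finTimesFinDual]
  refine and_congr ⟨fun h' => ?_, fun h' => ?_⟩ ?_
  · by_contra hp
    exact h' ⟨p, hp, h.apply_base⟩
  · rintro ⟨x, hx, hxi⟩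
    exact hx ((h.eq_infty_iff x).1 hxi ▸ h')
  · simp only [Set.mem_ofPred_eq, Set.mem_compl_iff, Set.mem_image, not_exists, not_and]
    refine eventually_congr (.of_forall fun n => eventually_congr (.of_forall fun m => ?_))
    exact forall_congr' fun y => by tauto

theorem base_mem_closure (h : IsFinFinFibration π p) {A : Set X} :
    p ∈ closure A ↔
      p ∈ A ∨ ∃ᶠ n in atTop, ∃ᶠ m in atTop, ∃ y ∈ A, π y = FilterSpace.pt (n, m) := by
  rw [closure_eq_compl_interior_compl, Set.mem_compl_iff, mem_interior_iff_mem_nhds,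
    h.mem_nhds_base, not_and_or]
  simp only [Set.mem_compl_iff, not_not, not_eventually, not_forall, exists_prop]
  simp only [and_comm]

theorem perfectSpace (h : IsFinFinFibration π p) (hx : ∀ x, x ≠ p → (𝓝[≠] x).NeBot) :
    PerfectSpace X := by
  rw [perfectSpace_iff_forall_not_isolated]
  intro x
  by_cases hxp : x = p
  · subst hxp
    rw [← mem_closure_iff_nhdsWithin_neBot, h.base_mem_closure]
    refine Or.inr (Frequently.of_forall fun n => Frequently.of_forall fun m => ?_)
    obtain ⟨y, hy⟩ := h.exists_eq_pt (n, m)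
    exact ⟨y, h.ne_of_eq_pt hy, hy⟩
  · exact hx x hxp

/-- The topology is even Borel: being a neighbourhood of a given point is expressed by quantifiers
over `ℕ` and the countable set `X`. -/
theorem hasAnalyticTopology [Countable X] (h : IsFinFinFibration π p) :
    HasAnalyticTopology X := by
  have heval : ∀ x : X, Measurable fun χ : X → Bool => χ x = true := fun x =>
    measurableSet_setOfPred.1 ((measurable_pi_apply (X := fun _ : X => Bool) x)
      (measurableSet_singleton true))
  have hs : ∀ χ : X → Bool, IsOpen {x | χ x = true} ↔
      ∀ x, χ x = true → {y | χ y = true} ∈ 𝓝 x := fun χ => isOpen_iff_mem_nhds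
  have hm : ∀ x : X, Measurable fun χ : X → Bool => {y | χ y = true} ∈ 𝓝 x := by
    intro x
    by_cases hxp : x = p
    · subst hxp
      simp only [h.mem_nhds_base, eventually_atTop, Set.mem_ofPred_eq]
      refine (heval x).and (Measurable.exists fun N => Measurable.forall fun n =>
        Measurable.forall fun _ => Measurable.exists fun M => Measurable.forall fun m =>
        Measurable.forall fun _ => Measurable.forall fun y => Measurable.forall fun _ => heval y)
    · have := h.isCountablyGenerated x hxp
      obtain ⟨b, hb⟩ := (𝓝 x).exists_antitone_basis
      simp only [hb.mem_iff, Set.subset_def, Set.mem_ofPred_eq]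
      exact Measurable.exists fun i => Measurable.forall fun y => Measurable.forall fun _ => heval y
  have := polishSpace_pi_bool X
  refine MeasurableSet.analyticSet (measurableSet_setOfPred.2 ?_)
  simp only [hs]
  exact Measurable.forall fun x => (heval x).imp (hm x)

theorem not_hasCountableFanTightness (h : IsFinFinFibration π p) :
    ¬ HasCountableFanTightness X := by
  intro hX
  obtain ⟨K, hK, hp⟩ := hX p (fun k => {x | ∃ n m, k ≤ n ∧ π x = FilterSpace.pt (n, m)}) (by
    intro k
    refine h.base_mem_closure.2 (Or.inr (Eventually.frequently ?_))
    filter_upwards [eventually_ge_atTop k] with n hn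
    refine Frequently.of_forall fun m => ?_
    obtain ⟨y, hy⟩ := h.exists_eq_pt (n, m)
    exact ⟨y, ⟨n, m, hn, hy⟩, hy⟩)
  rcases h.base_mem_closure.1 hp with hp | hp
  · obtain ⟨k, hk⟩ := Set.mem_iUnion.1 hp
    obtain ⟨n, m, -, hy⟩ := (hK k).2 hk
    exact h.ne_of_eq_pt hy rfl
  · obtain ⟨n, hn⟩ := hp.exists
    rw [Nat.frequently_atTop_iff_infinite] at hn
    -- Points of `K k` lie over columns `≥ k`, so only `K 0, …, K n` reach column `n`.
    refine hn (Set.Finite.subset (s := ⋃ k ∈ Set.Iic n,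
      (fun m => FilterSpace.pt (n, m)) ⁻¹' (π '' K k)) ?_ ?_)
    · refine (Set.finite_Iic n).biUnion fun k _ => ((hK k).1.image π).preimage ?_
      intro a _ b _ hab
      exact (Prod.ext_iff.1 (FilterSpace.pt_injective hab)).2
    · rintro m ⟨y, hy, hym⟩
      obtain ⟨k, hk⟩ := Set.mem_iUnion.1 hy
      obtain ⟨n', m', hle, hy'⟩ := (hK k).2 hk
      have := FilterSpace.pt_injective (hym.symm.trans hy')
      simp only [Prod.mk.injEq] at this
      exact Set.mem_biUnion (x := k) (by rw [Set.mem_Iic]; omega) ⟨y, hk, hym⟩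

/-- One point from each `D k` suffices: enumerate the basic neighbourhoods of all points other than
`p` and pick from the `k`-th. The point `p` comes for free, being in the closure of the other
points. -/
theorem isSelectivelySeparable [Countable X] (h : IsFinFinFibration π p) :
    IsSelectivelySeparable X := by
  intro D hD
  have hb : ∀ x : {x : X // x ≠ p}, ∃ b : ℕ → Set X, (𝓝 x.1).HasAntitoneBasis b := fun x =>
    have := h.isCountablyGenerated x.1 x.2
    (𝓝 x.1).exists_antitone_basis
  choose b hb using hb
  have hne : Nonempty ({x : X // x ≠ p} × ℕ) := by
    obtain ⟨y, hy⟩ := h.exists_eq_pt (0, 0)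
    exact ⟨⟨y, h.ne_of_eq_pt hy⟩, 0⟩
  obtain ⟨e, he⟩ := exists_surjective_nat ({x : X // x ≠ p} × ℕ)
  have hsel : ∀ k, ∃ a ∈ D k, a ∈ b (e k).1 (e k).2 := by
    intro k
    obtain ⟨a, ha, haD⟩ := mem_closure_iff_nhds.1 (hD k (e k).1.1) _
      ((hb (e k).1).mem (e k).2)
    exact ⟨a, haD, ha⟩
  choose a haD hab using hsel
  refine ⟨fun k => {a k}, fun k => ⟨Set.finite_singleton _, Set.singleton_subset_iff.2 (haD k)⟩, ?_⟩
  have hx : ∀ x, x ≠ p → x ∈ closure (⋃ k, {a k}) := by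
    intro x hx
    rw [mem_closure_iff_nhds]
    intro U hU
    obtain ⟨i, hi⟩ := (hb ⟨x, hx⟩).mem_iff.1 hU
    obtain ⟨k, hk⟩ := he (⟨x, hx⟩, i)
    have := hab k
    rw [hk] at this
    exact ⟨a k, hi this, Set.mem_iUnion.2 ⟨k, rfl⟩⟩
  intro x
  by_cases hxp : x = p
  · subst hxp
    rw [← closure_closure, h.base_mem_closure]
    refine Or.inr (Frequently.of_forall fun n => Frequently.of_forall fun m => ?_)
    obtain ⟨y, hy⟩ := h.exists_eq_pt (n, m)
    exact ⟨y, hx y (h.ne_of_eq_pt hy), hy⟩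
  · exact hx x hxp

/-- At `p`, accumulation depends only on which fibres are met, so one point per fibre met is enough,
and the fibres are open. Elsewhere a convergent sequence works. -/
theorem isDiscretelyGenerated [T2Space X] (h : IsFinFinFibration π p) :
    IsDiscretelyGenerated X := by
  intro A x hx
  by_cases hxA : x ∈ A
  · exact ⟨{x}, Set.singleton_subset_iff.2 hxA, inferInstance, subset_closure rfl⟩
  by_cases hxp : x = p
  · subst hxp
    have hA : ∀ a : A, ∃ z, π a = FilterSpace.pt z := fun a =>
      h.exists_pt_of_ne fun h' => hxA (h' ▸ a.2)
    choose c hc using hA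
    let r : ℕ × ℕ → Set X := fun z => {y | y ∈ A ∧ π y = FilterSpace.pt z}
    have : ∀ z : {z // (r z).Nonempty}, ∃ y, y ∈ r z := fun z => z.2
    choose s hs using this
    refine ⟨Set.range s, Set.range_subset_iff.2 fun z => (hs z).1, ?_, ?_⟩
    · rw [discreteTopology_subtype_iff']
      rintro _ ⟨z, rfl⟩
      refine ⟨{x | π x = FilterSpace.pt z.1}, h.isOpen_fiber z.1, ?_⟩
      ext y
      constructor
      · rintro ⟨hy, ⟨w, rfl⟩⟩
        have : w = z := Subtype.ext (FilterSpace.pt_injective ((hs w).2.symm.trans hy))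
        rw [this]; rfl
      · rintro rfl
        exact ⟨(hs z).2, z, rfl⟩
    · refine h.base_mem_closure.2 (Or.inr ?_)
      refine ((h.base_mem_closure.1 hx).resolve_left hxA).mono fun n hn => hn.mono fun m hm => ?_
      exact ⟨s ⟨(n, m), hm⟩, ⟨_, rfl⟩, (hs ⟨(n, m), hm⟩).2⟩
  · have := h.isCountablyGenerated x hxp
    obtain ⟨u, hu, hux⟩ := exists_seq_forall_of_frequently
      (mem_closure_iff_frequently.1 hx)
    refine ⟨Set.range u, Set.range_subset_iff.2 hux, ?_, ?_⟩
    · exact discreteTopology_range_of_tendsto hu fun n h' => hxA (h' ▸ hux n)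
    · exact mem_closure_of_tendsto hu (.of_forall fun n => ⟨n, rfl⟩)

theorem isQPlus [T1Space X] (h : IsFinFinFibration π p) : IsQPlus X := by
  intro A x hx F hF hdisj hU
  by_cases hxA : x ∈ A
  · exact ⟨{x}, Set.singleton_subset_iff.2 hxA, subset_closure rfl,
      fun n => Set.subsingleton_singleton.anti Set.inter_subset_left⟩
  have hν : ∀ a : X, ∃ n, a ∈ A → a ∈ F n := by
    intro a
    by_cases ha : a ∈ A
    · obtain ⟨n, hn⟩ := Set.mem_iUnion.1 (hU.symm ▸ ha)
      exact ⟨n, fun _ => hn⟩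
    · exact ⟨0, fun h' => absurd h' ha⟩
  choose ν hν using hν
  have hν' : ∀ a ∈ A, ∀ n, a ∈ F n → ν a = n := fun a ha n hn =>
    by_contra fun hne => (hdisj hne).le_bot ⟨hν a ha, hn⟩
  -- As the pieces are finite, an infinite set meets infinitely many of them.
  have hinf : ∀ B : Set X, B ⊆ A → B.Infinite → (ν '' B).Infinite := by
    intro B hBA hB hfin
    refine hB ((hfin.biUnion fun n _ => hF n).subset fun a ha => ?_)
    exact Set.mem_biUnion ⟨a, ha, rfl⟩ (hν a (hBA ha))
  have main : ∀ {ι : Type} [Countable ι] (B : ι → Set X), (∀ i, B i ⊆ A) → (∀ i, (B i).Infinite) →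
      (∀ s : ι → X, (∀ i, s i ∈ B i) → x ∈ closure (Set.range s)) →
      ∃ S : Set X, S ⊆ A ∧ x ∈ closure S ∧ ∀ n, (S ∩ F n).Subsingleton := by
    intro ι _ B hBA hB hcl
    obtain ⟨s, hs, hinj⟩ := exists_injective_selection ν B fun i => hinf _ (hBA i) (hB i)
    refine ⟨Set.range s, Set.range_subset_iff.2 fun i => hBA i (hs i), hcl s hs, ?_⟩
    rintro n _ ⟨⟨i, rfl⟩, hi⟩ _ ⟨⟨j, rfl⟩, hj⟩
    congr 1
    exact hinj ((hν' _ (hBA i (hs i)) n hi).trans (hν' _ (hBA j (hs j)) n hj).symm)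
  by_cases hxp : x = p
  · subst hxp
    have hfr := (h.base_mem_closure.1 hx).resolve_left hxA
    let J := {n : ℕ // ∃ᶠ m in atTop, ∃ y ∈ A, π y = FilterSpace.pt (n, m)}
    -- One point for each good column and each height bound `k` makes the selection unbounded in
    -- every good column.
    refine main (ι := J × ℕ)
      (fun i => {y | y ∈ A ∧ ∃ m, i.2 ≤ m ∧ π y = FilterSpace.pt (i.1.1, m)})
      (fun i y hy => hy.1) ?_ ?_
    · rintro ⟨⟨n, hn⟩, k⟩ hfin
      have h2 := hn.and_eventually (eventually_ge_atTop k)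
      rw [Nat.frequently_atTop_iff_infinite] at h2
      refine h2 (((hfin.image π).preimage (f := fun m => FilterSpace.pt (n, m)) ?_).subset ?_)
      · intro a _ b _ hab
        exact (Prod.ext_iff.1 (FilterSpace.pt_injective hab)).2
      · rintro m ⟨⟨y, hy, hym⟩, hkm⟩
        exact ⟨y, ⟨hy, m, hkm, hym⟩, hym⟩
    · intro s hs
      refine h.base_mem_closure.2 (Or.inr (hfr.mono fun n hn => ?_))
      rw [frequently_atTop]
      intro k
      obtain ⟨-, m, hkm, hm⟩ := hs (⟨n, hn⟩, k)
      exact ⟨m, hkm, _, ⟨_, rfl⟩, hm⟩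
  · have := h.isCountablyGenerated x hxp
    obtain ⟨b, hb⟩ := (𝓝 x).exists_antitone_basis
    refine main (ι := ℕ) (fun i => b i ∩ A) (fun i => Set.inter_subset_right) ?_ ?_
    · intro i hfin
      -- A finite trace of `A` could be removed, leaving a neighbourhood of `x` disjoint from `A`.
      have : (b i ∩ A)ᶜ ∈ 𝓝 x := hfin.isClosed.isOpen_compl.mem_nhds fun h' => hxA h'.2
      obtain ⟨y, hy, hyA⟩ := mem_closure_iff_nhds.1 hx _ (inter_mem this (hb.mem i))
      exact hy.1 ⟨hy.2, hyA⟩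
    · intro s hs
      exact mem_closure_of_tendsto (hb.tendsto fun i => (hs i).1) (.of_forall fun n => ⟨n, rfl⟩)

end IsFinFinFibration

/-! ### Regularity of `Z` and existence of `f`. -/

namespace FilterSpace

/-- Every set containing `∞` is closed, and `hF` makes the isolated singletons closed too. -/
theorem t3Space {X : Type*} {F : Filter X} (hF : F ≤ cofinite) : T3Space (FilterSpace F) := by
  have hcl : ∀ x : X, IsClosed {(pt x : FilterSpace F)} := by
    intro x
    rw [← isOpen_compl_iff, isOpen_iff]
    refine fun _ => mem_of_superset (hF (Set.finite_singleton x).compl_mem_cofinite) ?_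
    intro y hy hy'
    exact hy (pt_injective hy')
  have hcl' : ∀ U : Set (FilterSpace F), infty ∈ U → IsClosed U := fun U hU =>
    isOpen_compl_iff.1 (isOpen_of_infty_notMem fun h => h hU)
  have : T1Space (FilterSpace F) := ⟨fun z => by
    rcases eq_infty_or_eq_pt z with rfl | ⟨x, rfl⟩
    · exact hcl' _ rfl
    · exact hcl x⟩
  have : RegularSpace (FilterSpace F) := .of_exists_mem_nhds_isClosed_subset fun z s hs => by
    rcases eq_infty_or_eq_pt z with rfl | ⟨x, rfl⟩
    · exact ⟨s, hs, hcl' s (mem_of_mem_nhds hs), subset_rfl⟩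
    · refine ⟨{pt x}, ?_, hcl x, Set.singleton_subset_iff.2 (mem_of_mem_nhds hs)⟩
      rw [nhds_pt]
      exact rfl
  exact {}

end FilterSpace

theorem finTimesFinDual_le_cofinite : finTimesFinDual ≤ cofinite := by
  intro A hA
  refine mem_finTimesFinDual.2 (.of_forall fun n => ?_)
  rw [← Nat.cofinite_eq_atTop]
  exact Set.Finite.preimage (f := fun m => (n, m)) (by intro a _ b _ h; simpa using h)
    (mem_cofinite.1 hA)

instance : T3Space FinFinSpace := FilterSpace.t3Space finTimesFinDual_le_cofinite

theorem exists_isColumnDoubling : ∃ f : FinFinSpace → FinFinSpace, IsColumnDoubling f := by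
  let f : FinFinSpace → FinFinSpace := fun z =>
    Option.elim (show Option (ℕ × ℕ) from z) FilterSpace.infty
      fun z => FilterSpace.pt (z.1, z.2 / 2)
  have h1 : f FilterSpace.infty = FilterSpace.infty := rfl
  have h2 : ∀ z : ℕ × ℕ, f (FilterSpace.pt z) = FilterSpace.pt (z.1, z.2 / 2) := fun z => rfl
  refine ⟨f, h1, fun n => ?_, fun n m => ?_⟩
  · ext z
    rcases FilterSpace.eq_infty_or_eq_pt z with rfl | ⟨⟨a, b⟩, rfl⟩
    · simp [h1, FilterSpace.pt_ne_infty]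
    · simp only [Set.mem_preimage, h2, Set.mem_range, FilterSpace.pt_injective.eq_iff,
        Prod.mk.injEq]
      exact ⟨fun ⟨y, h, _⟩ => ⟨b, h, rfl⟩, fun ⟨y, h, _⟩ => ⟨b / 2, h, rfl⟩⟩
  · rw [Set.ncard_eq_two]
    refine ⟨FilterSpace.pt (n, 2 * m), FilterSpace.pt (n, 2 * m + 1), ?_, ?_⟩
    · simp [FilterSpace.pt_injective.eq_iff]
    · ext z
      rcases FilterSpace.eq_infty_or_eq_pt z with rfl | ⟨⟨a, b⟩, rfl⟩
      · simp [h1, (FilterSpace.pt_ne_infty _).symm]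
      · simp only [Set.mem_preimage, h2, Set.mem_singleton_iff, Set.mem_insert_iff,
          FilterSpace.pt_injective.eq_iff, Prod.mk.injEq]
        omega

/-! ### Column-doubling maps near `∞`. -/

namespace IsColumnDoubling

variable {f : FinFinSpace → FinFinSpace}

theorem exists_map_pt (hf : IsColumnDoubling f) (n m : ℕ) :
    ∃ k, f (FilterSpace.pt (n, m)) = FilterSpace.pt (n, k) := by
  have : (FilterSpace.pt (n, m) : FinFinSpace) ∈
      f ⁻¹' (Set.range fun m : ℕ => FilterSpace.pt (n, m)) := by
    rw [hf.preimage_column]; exact ⟨m, rfl⟩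
  obtain ⟨k, hk⟩ := this
  exact ⟨k, hk.symm⟩

theorem map_eq_infty_iff (hf : IsColumnDoubling f) {z : FinFinSpace} :
    f z = FilterSpace.infty ↔ z = FilterSpace.infty := by
  refine ⟨fun h => ?_, fun h => h ▸ hf.map_infty⟩
  rcases FilterSpace.eq_infty_or_eq_pt z with rfl | ⟨⟨n, m⟩, rfl⟩
  · rfl
  · obtain ⟨k, hk⟩ := hf.exists_map_pt n m
    exact absurd (hk.symm.trans h) (FilterSpace.pt_ne_infty _)

theorem exists_pt_of_map_eq (hf : IsColumnDoubling f) {z : FinFinSpace} {n m : ℕ}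
    (h : f z = FilterSpace.pt (n, m)) : ∃ k, z = FilterSpace.pt (n, k) := by
  have : z ∈ f ⁻¹' (Set.range fun m : ℕ => FilterSpace.pt (n, m)) := ⟨m, h.symm⟩
  rw [hf.preimage_column] at this
  obtain ⟨k, hk⟩ := this
  exact ⟨k, hk.symm⟩

theorem preimage_finite (hf : IsColumnDoubling f) (z : ℕ × ℕ) :
    (f ⁻¹' {FilterSpace.pt z}).Finite :=
  Set.finite_of_ncard_ne_zero (by rw [hf.preimage_point z.1 z.2]; decide)

/-- On column `n`, `f` acts as a finite-to-one map `g n`. Finite fibres give one inclusion; the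
other holds because images of finite sets are finite. -/
theorem comap_nhds_infty (hf : IsColumnDoubling f) :
    comap f (𝓝 FilterSpace.infty) = 𝓝 FilterSpace.infty := by
  choose g hg using hf.exists_map_pt
  have hpre : ∀ n k, (g n ⁻¹' {k}).Finite := by
    intro n k
    refine ((hf.preimage_finite (n, k)).preimage (f := fun m => FilterSpace.pt (n, m)) ?_).subset ?_
    · intro a _ b _ h
      exact (Prod.ext_iff.1 (FilterSpace.pt_injective h)).2
    · rintro m rfl
      exact hg n m
  have hg' : ∀ n, Tendsto (g n) atTop atTop := by
    intro n
    rw [← Nat.cofinite_eq_atTop]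
    exact Tendsto.cofinite_of_finite_preimage_singleton fun k => hpre n k
  ext U
  rw [mem_comap_iff_compl, FilterSpace.mem_nhds_infty, FilterSpace.mem_nhds_infty,
    mem_finTimesFinDual, mem_finTimesFinDual]
  refine and_congr ?_ (eventually_congr (.of_forall fun n => ?_))
  · simp [hf.map_eq_infty_iff]
  · have key : ∀ k, (FilterSpace.pt (n, k) : FinFinSpace) ∈ (f '' Uᶜ)ᶜ ↔
        ∀ m, g n m = k → (FilterSpace.pt (n, m) : FinFinSpace) ∈ U := by
      intro k
      constructor
      · intro h m hm
        by_contra hU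
        exact h ⟨_, hU, by rw [hg, hm]⟩
      · rintro h ⟨z, hz, hzk⟩
        obtain ⟨m, rfl⟩ := hf.exists_pt_of_map_eq hzk
        rw [hg] at hzk
        exact hz (h m (Prod.ext_iff.1 (FilterSpace.pt_injective hzk)).2)
    simp only [Set.mem_ofPred_eq, key]
    constructor
    · intro h
      exact ((hg' n).eventually h).mono fun m hm => hm m rfl
    · intro h
      rw [← Nat.cofinite_eq_atTop, eventually_cofinite] at h ⊢
      refine (h.image (g n)).subset ?_
      intro k hk
      simp only [Set.mem_ofPred_eq, not_forall] at hk
      obtain ⟨m, hm, hmU⟩ := hk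
      exact ⟨m, hmU, hm⟩

theorem continuous (hf : IsColumnDoubling f) : Continuous f := by
  rw [continuous_iff_continuousAt]
  intro z
  rcases FilterSpace.eq_infty_or_eq_pt z with rfl | ⟨x, rfl⟩
  · rw [ContinuousAt, hf.map_infty, tendsto_iff_comap, hf.comap_nhds_infty]
  · rw [ContinuousAt, FilterSpace.nhds_pt]
    exact tendsto_pure_left.2 fun s hs => mem_of_mem_nhds hs

theorem apply_eq_infty_iff (hf : IsColumnDoubling f) {x : ℕ → FinFinSpace}
    (hx : x ∈ inverseLimit fun _ => f) (k : ℕ) :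
    x k = FilterSpace.infty ↔ x 0 = FilterSpace.infty := by
  induction k with
  | zero => rfl
  | succ k ih => rw [← ih, hx k, hf.map_eq_infty_iff]

theorem comap_apply_nhds_infty (hf : IsColumnDoubling f) {S : Set (ℕ → FinFinSpace)}
    (hS : S ⊆ inverseLimit fun _ => f) (k : ℕ) :
    comap (fun x : S => x.1 k) (𝓝 FilterSpace.infty) =
      comap (fun x : S => x.1 0) (𝓝 FilterSpace.infty) := by
  induction k with
  | zero => rfl
  | succ k ih =>
    rw [← ih]
    nth_rw 1 [← hf.comap_nhds_infty]
    rw [comap_comap]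
    congr 1
    ext x
    exact (hS x.2 k).symm

end IsColumnDoubling

/-! ### Cylinder neighbourhoods in the inverse limit. -/

theorem nhds_subtype_pi {Z : Type*} [TopologicalSpace Z] (S : Set (ℕ → Z)) (x : S) :
    𝓝 x = ⨅ k, comap (fun y : S => y.1 k) (𝓝 (x.1 k)) := by
  rw [nhds_subtype_eq_comap, nhds_pi, Filter.pi, comap_iInf]
  simp only [comap_comap]
  rfl

theorem apply_eq_of_le {X : ℕ → Type*} {f : ∀ n, X (n + 1) → X n} {x y : ∀ n, X n}
    (hx : x ∈ inverseLimit f) (hy : y ∈ inverseLimit f) {j k : ℕ} (hjk : j ≤ k)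
    (h : x k = y k) : x j = y j := by
  induction hjk using Nat.decreasingInduction with
  | self => exact h
  | of_succ j _ ih => rw [hx j, hy j, ih]

/-- At a point of an inverse limit with isolated coordinates, the cylinders form a basis. -/
theorem hasAntitoneBasis_cylinder {f : FinFinSpace → FinFinSpace} {S : Set (ℕ → FinFinSpace)}
    (hS : S ⊆ inverseLimit fun _ => f) (x : S) (hx : ∀ k, x.1 k ≠ FilterSpace.infty) :
    (𝓝 x).HasAntitoneBasis fun k => {y : S | y.1 k = x.1 k} := by
  have hnhds : ∀ k, 𝓝 (x.1 k) = pure (x.1 k) := by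
    intro k
    obtain ⟨z, hz⟩ := (FilterSpace.eq_infty_or_eq_pt (x.1 k)).resolve_left (hx k)
    rw [hz, FilterSpace.nhds_pt]
  have hanti : Antitone fun k => {y : S | y.1 k = x.1 k} := fun j k hjk y hy =>
    apply_eq_of_le (hS y.2) (hS x.2) hjk hy
  have : 𝓝 x = ⨅ k, 𝓟 {y : S | y.1 k = x.1 k} := by
    rw [nhds_subtype_pi]
    refine iInf_congr fun k => ?_
    rw [hnhds, ← principal_singleton, comap_principal]
    rfl
  rw [this]
  exact .iInf_principal hanti

instance : Countable FinFinSpace := inferInstanceAs (Countable (Option (ℕ × ℕ)))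

/-! ### Existence of crowded selections. -/

namespace IsColumnDoubling

variable {f : FinFinSpace → FinFinSpace}

theorem surjective (hf : IsColumnDoubling f) : Function.Surjective f := by
  intro z
  rcases FilterSpace.eq_infty_or_eq_pt z with rfl | ⟨⟨n, m⟩, rfl⟩
  · exact ⟨_, hf.map_infty⟩
  · have h : (f ⁻¹' {FilterSpace.pt (n, m)}).Nonempty :=
      Set.nonempty_of_ncard_ne_zero (by rw [hf.preimage_point n m]; decide)
    exact h

theorem exists_ne_map_eq (hf : IsColumnDoubling f) {z : FinFinSpace}
    (hz : z ≠ FilterSpace.infty) (w : FinFinSpace) : ∃ w', w' ≠ w ∧ f w' = z := by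
  obtain ⟨⟨n, m⟩, rfl⟩ := (FilterSpace.eq_infty_or_eq_pt z).resolve_left hz
  obtain ⟨a, ha, hne⟩ := Set.exists_ne_of_one_lt_ncard
    (by rw [hf.preimage_point n m]; decide : 1 < (f ⁻¹' {FilterSpace.pt (n, m)}).ncard) w
  exact ⟨a, hne, ha⟩

end IsColumnDoubling

/-- If `s` is a section of `f`, then every point at every level extends to a point of the inverse
limit that follows `s` from that level on. -/
theorem exists_mem_inverseLimit_of_rightInverse {Z : Type*} {f s : Z → Z}
    (hs : Function.RightInverse s f) (k : ℕ) (z : Z) :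
    ∃ x ∈ inverseLimit (fun _ => f), x k = z ∧ ∀ j, k ≤ j → x (j + 1) = s (x j) := by
  -- With truncated subtraction at least one exponent is `0`: below level `k` only `f` acts, above
  -- it only `s`.
  refine ⟨fun j => f^[k - j] (s^[j - k] z), fun j => ?_, by simp, fun j hj => ?_⟩
  · rcases lt_or_ge j k with h | h
    · have h1 : k - j = (k - (j + 1)) + 1 := by omega
      have h2 : j - k = 0 := by omega
      have h3 : j + 1 - k = 0 := by omega
      simp only [h1, h2, h3, Function.iterate_succ_apply']
    · have h1 : k - j = 0 := by omega
      have h2 : k - (j + 1) = 0 := by omega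
      have h3 : j + 1 - k = (j - k) + 1 := by omega
      simp only [h1, h2, h3, Function.iterate_succ_apply', Function.iterate_zero, id]
      exact (hs _).symm
  · have h1 : k - j = 0 := by omega
    have h2 : k - (j + 1) = 0 := by omega
    have h3 : j + 1 - k = (j - k) + 1 := by omega
    simp only [h1, h2, h3, Function.iterate_succ_apply', Function.iterate_zero, id]

/-- Take the threads that eventually follow a fixed section `s` of `f`. Such a thread is determined
by a level and its entry there, so there are countably many. -/
theorem IsColumnDoubling.exists_isCrowdedSelection {f : FinFinSpace → FinFinSpace}
    (hf : IsColumnDoubling f) :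
    ∃ D : ℕ → ℕ → Set (ℕ → FinFinSpace), IsCrowdedSelection f D := by
  obtain ⟨s, hs⟩ := hf.surjective.hasRightInverse
  let D : ℕ → ℕ → Set (ℕ → FinFinSpace) := fun n m =>
    {x | x ∈ inverseLimit (fun _ => f) ∧ x 0 = FilterSpace.pt (n, m) ∧
      ∃ k, ∀ j, k ≤ j → x (j + 1) = s (x j)}
  have hsub : ∀ n m, D n m ⊆ inverseLimit (fun _ => f) := fun n m x hx => hx.1
  refine ⟨D, fun n m => ?_, fun n m => ?_, fun n m => ?_, hsub, fun n m x hx => hx.2.1⟩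
  · obtain ⟨x, hx, hx0, hxs⟩ :=
      exists_mem_inverseLimit_of_rightInverse hs 0 (FilterSpace.pt (n, m))
    exact ⟨x, hx, hx0, 0, hxs⟩
  · let E : ℕ → Set (ℕ → FinFinSpace) := fun k =>
      {x | x ∈ inverseLimit (fun _ => f) ∧ ∀ j, k ≤ j → x (j + 1) = s (x j)}
    have hE : ∀ k, (E k).Countable := by
      intro k
      refine Set.MapsTo.countable_of_injOn (f := fun x => x k) (t := Set.univ)
        (fun _ _ => trivial) ?_ (Set.countable_univ)
      intro x hx y hy hxy
      ext j
      rcases le_total j k with h | h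
      · exact apply_eq_of_le hx.1 hy.1 h hxy
      · induction j, h using Nat.le_induction with
        | base => exact hxy
        | succ j hj ih => rw [hx.2 j hj, hy.2 j hj, ih]
    refine (Set.countable_iUnion hE).mono ?_
    rintro x ⟨hx, -, k, hk⟩
    exact Set.mem_iUnion.2 ⟨k, hx, hk⟩
  · rw [perfectSpace_iff_forall_not_isolated]
    intro x
    have hx : ∀ k, x.1 k ≠ FilterSpace.infty := fun k h => by
      rw [hf.apply_eq_infty_iff x.2.1, x.2.2.1] at h
      exact FilterSpace.pt_ne_infty _ h
    rw [← mem_closure_iff_nhdsWithin_neBot, mem_closure_iff_nhds]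
    intro U hU
    obtain ⟨k, hk⟩ := (hasAntitoneBasis_cylinder (hsub n m) x hx).mem_iff.1 hU
    -- Branching to the other preimage at level `k + 1` and following `s` afterwards gives a new
    -- point in the cylinder of `x` at level `k`.
    obtain ⟨w, hw, hwk⟩ := hf.exists_ne_map_eq (hx k) (x.1 (k + 1))
    obtain ⟨y, hy, hyw, hys⟩ := exists_mem_inverseLimit_of_rightInverse hs (k + 1) w
    have hyk : y k = x.1 k := by rw [← hwk, ← hyw]; exact hy k
    refine ⟨⟨y, hy, ?_, k + 1, hys⟩, hk hyk, ?_⟩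
    · rw [apply_eq_of_le hy x.2.1 (Nat.zero_le k) hyk, x.2.2.1]
    · intro h
      exact hw (hyw.symm.trans (congrFun (congrArg Subtype.val (Set.mem_singleton_iff.1 h)) _))

/-! ### The space `X` as a fibration over `Z`. -/

namespace IsCrowdedSelection

variable {f : FinFinSpace → FinFinSpace} {D : ℕ → ℕ → Set (ℕ → FinFinSpace)}

theorem selectionSpace_subset (hD : IsCrowdedSelection f D) (hf : IsColumnDoubling f) :
    selectionSpace D ⊆ inverseLimit (fun _ => f) := by
  rintro x (hx | rfl)
  · obtain ⟨n, m, h⟩ := Set.mem_iUnion₂.1 hx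
    exact hD.subset_limit n m h
  · exact fun _ => hf.map_infty.symm

theorem countable_selectionSpace (hD : IsCrowdedSelection f D) : Countable (selectionSpace D) :=
  ((Set.countable_iUnion fun n => Set.countable_iUnion fun m => hD.countable n m).union
    (Set.countable_singleton _)).to_subtype

theorem subset_selectionSpace (D : ℕ → ℕ → Set (ℕ → FinFinSpace)) (n m : ℕ) :
    D n m ⊆ selectionSpace D :=
  fun _ hx => Or.inl (Set.mem_iUnion₂.2 ⟨n, m, hx⟩)

theorem isFinFinFibration (hD : IsCrowdedSelection f D) (hf : IsColumnDoubling f) :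
    IsFinFinFibration (fun x : selectionSpace D => x.1 0)
      ⟨fun _ => FilterSpace.infty, Or.inr rfl⟩ := by
  have hS := hD.selectionSpace_subset hf
  have heq : ∀ x : selectionSpace D, x.1 0 = FilterSpace.infty ↔
      x = ⟨fun _ => FilterSpace.infty, Or.inr rfl⟩ := fun x =>
    ⟨fun h => Subtype.ext (funext fun k => (hf.apply_eq_infty_iff (hS x.2) k).2 h),
      fun h => h ▸ rfl⟩
  refine ⟨?_, heq, (continuous_apply 0).comp continuous_subtype_val, ?_, ?_⟩
  · rw [nhds_subtype_pi]
    simp only [hf.comap_apply_nhds_infty hS, iInf_const]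
  · rintro ⟨n, m⟩
    obtain ⟨x, hx⟩ := hD.nonempty n m
    exact ⟨⟨x, subset_selectionSpace D n m hx⟩, hD.first_coord n m x hx⟩
  · intro x hx
    refine (hasAntitoneBasis_cylinder hS x fun k hk => hx ?_).1.isCountablyGenerated
    exact (heq x).1 ((hf.apply_eq_infty_iff (hS x.2) k).1 hk)

theorem perfectSpace (hD : IsCrowdedSelection f D) (hf : IsColumnDoubling f) :
    PerfectSpace (selectionSpace D) := by
  refine (hD.isFinFinFibration hf).perfectSpace fun x hx => ?_
  have hxD := x.2.resolve_right fun h => hx (Subtype.ext h)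
  obtain ⟨n, m, hxD⟩ := Set.mem_iUnion₂.1 hxD
  -- Non-isolation passes from `D n m` to `X` along the continuous injective inclusion.
  have hperf := perfectSpace_iff_forall_not_isolated.1 (hD.crowded n m) ⟨x.1, hxD⟩
  rw [← mem_closure_iff_nhdsWithin_neBot, mem_closure_iff_nhds] at hperf ⊢
  intro U hU
  obtain ⟨y, hyU, hy⟩ := hperf _
    ((continuous_inclusion (subset_selectionSpace D n m)).continuousAt.preimage_mem_nhds hU)
  exact ⟨_, hyU, fun h => hy (Set.inclusion_injective (subset_selectionSpace D n m) h)⟩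

end IsCrowdedSelection

theorem mainTheorem6 :
    (∃ f : FinFinSpace → FinFinSpace, IsColumnDoubling f) ∧
    ∀ f : FinFinSpace → FinFinSpace, IsColumnDoubling f →
      Continuous f ∧
      (∃ D : ℕ → ℕ → Set (ℕ → FinFinSpace), IsCrowdedSelection f D) ∧
      ∀ D : ℕ → ℕ → Set (ℕ → FinFinSpace), IsCrowdedSelection f D →
        selectionSpace D ⊆ inverseLimit (fun _ => f) ∧
        Countable (selectionSpace D) ∧
        T3Space (selectionSpace D) ∧
        PerfectSpace (selectionSpace D) ∧
        HasAnalyticTopology (selectionSpace D) ∧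
        IsQPlus (selectionSpace D) ∧
        IsDiscretelyGenerated (selectionSpace D) ∧
        IsSelectivelySeparable (selectionSpace D) ∧
        ¬ HasCountableFanTightness (selectionSpace D) := by
  refine ⟨exists_isColumnDoubling, fun f hf => ⟨hf.continuous, hf.exists_isCrowdedSelection,
    fun D hD => ?_⟩⟩
  have h := hD.isFinFinFibration hf
  have := hD.countable_selectionSpace
  exact ⟨hD.selectionSpace_subset hf, this, inferInstance, hD.perfectSpace hf,
    h.hasAnalyticTopology, h.isQPlus, h.isDiscretelyGenerated, h.isSelectivelySeparable,
    h.not_hasCountableFanTightness⟩
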